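/- Dual numbers $a=a_{\rm st}+a_{\mathcal I}\epsilon$ ($a_{\rm st},a_{\mathcal I}\in\mathbb R$, $\epsilon^2=0$) are totally ordered lexicographically: $a<b$ iff $a_{\rm st}<b_{\rm st}$, or $a_{\rm st}=b_{\rm st}$ and $a_{\mathcal I}<b_{\mathcal I}$. Put $|a|=|a_{\rm st}|+\mathrm{sgn}(a_{\rm st})a_{\mathcal I}\epsilon$ if $a_{\rm st}\ne0$ and $|a|=|a_{\mathcal I}|\epsilon$ otherwise. A dual quaternion matrix is $Q=Q_{\rm st}+Q_{\mathcal I}\epsilon$ with quaternion matrices $Q_{\rm st},Q_{\mathcal I}$; it is appreciable if $Q_{\rm st}\neq 0$. Its $F$-norm and $F^*$-norm are the dual numbers $$\|Q\|_F=\|Q_{\rm st}\|_F+\frac{\mathrm{sc}(\mathrm{tr}(Q_{\rm st}^*Q_{\mathcal I}))}{\|Q_{\rm st}\|_F}\epsilon,\qquad \|Q\|_{F^*}=\|Q_{\rm st}\|_F+\frac{\|Q_{\mathcal I}\|_F^2}{2\|Q_{\rm st}\|_F}\epsilon\qquad(Q_{\rm st}\ne 0),$$ where $\mathrm{sc}$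 is the scalar part of a quaternion, and both equal $\|Q_{\mathcal I}\|_F\,\epsilon$ if $Q_{\rm st}=0$. A dual quaternion vector $u$ has unit norm if $\|u\|_2=1$, where $\|u\|_2$ is the $F$-norm of $u$ regarded as an $n\times1$ matrix. The rank of $Q$ is the least $k$ such that $Q=BC$ with dual quaternion matrices $B$ having $k$ columns and $C$ having $k$ rows. A dual number $\lambda$ is an eigenvalue of a square matrix $Q$ with eigenvector $u$ if $u_{\rm st}\neq0$ and $Qu=u\lambda$. An eigenvalue $\lambda_1$ is dominant if $|\mu_{\rm st}|\le|\lambda_{1,\rm st}|$ for every eigenvalue $\mu$ of $Q$. **Lemma 4.4.** Let $Q$ be an appreciable $n\times n$ dual quaternion Hermitian matrix, $\lambda_1$ a dominant eigenvalue of $Q$, and $u_1$ an eigenvector for $\lambda_1$ with unit norm. (i) If $\lambda_1$ is the first eigenvalue in the descending order of magnitudes, that is, $|\mu|\le|\lambda_1|$ as dual numbers for every eigenvalue $\mu$ of $Q$ (as is the case, for instance, when every eigenvalue $\mu\neq\lambda_1$ has $|\mu_{\rm st}|<|\lambda_{1,\rm st}|$), then $(\lambda_1,u_1)$ minimizes $\|Q-\lambda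 uu^*\|_F^2$ over all dual numbers $\lambda$ and all dual quaternion vectors $u$ with unit norm. (ii) If $Q$ has rank one, then $(\lambda_1,u_1)$ minimizes $\|Q-\lambda uu^*\|_{F^*}^2$ over all dual numbers $\lambda$ and all dual quaternion vectors $u$ with unit norm. -/

import Mathlib

/-- Dual quaternions: pairs `q = q_st + q_I ε` of real quaternions with `ε² = 0`; the standard part
is `q.fst`, the dual part is `q.snd`, and the ring structure is the one of dual numbers. -/
abbrev DualQuaternion : Type := DualNumber (Quaternion ℝ)

namespace DualQuaternion

/-- The conjugate of a dual quaternion, `(q_st + q_I ε)* = q_st* + q_I* ε`. -/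
noncomputable instance instStarRing : StarRing DualQuaternion where
  star q := TrivSqZeroExt.inl (star q.fst) + TrivSqZeroExt.inr (star q.snd)
  star_involutive q := by
    apply TrivSqZeroExt.ext <;> simp
  star_mul p q := by
    apply TrivSqZeroExt.ext
    · simp
    · simp [add_comm]
  star_add p q := by
    apply TrivSqZeroExt.ext <;> simp

@[simp] theorem fst_star (q : DualQuaternion) : (star q).fst = star q.fst := by
  change (TrivSqZeroExt.inl (star q.fst) + TrivSqZeroExt.inr (star q.snd)).fst = _
  simp

@[simp] theorem snd_star (q : DualQuaternion) : (star q).snd = star q.snd := by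
  change (TrivSqZeroExt.inl (star q.fst) + TrivSqZeroExt.inr (star q.snd)).snd = _
  simp

end DualQuaternion

namespace DualMat

noncomputable section

/-! ### Dual numbers -/

/-- The dual number `x + y ε`. -/
def mk (x y : ℝ) : DualNumber ℝ := TrivSqZeroExt.inl x + TrivSqZeroExt.inr y

@[simp] theorem fst_mk (x y : ℝ) : (mk x y).fst = x := by simp [mk]

@[simp] theorem snd_mk (x y : ℝ) : (mk x y).snd = y := by simp [mk]

/-- The total order `a ≤ b` of dual numbers: lexicographic in (standard part, dual part). -/
def dle (a b : DualNumber ℝ) : Prop :=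
  a.fst < b.fst ∨ (a.fst = b.fst ∧ a.snd ≤ b.snd)

/-- The absolute value of a dual number. -/
def dabs (a : DualNumber ℝ) : DualNumber ℝ :=
  if a.fst ≠ 0 then mk |a.fst| (Real.sign a.fst * a.snd) else mk 0 |a.snd|

/-- The square root of a dual number with positive standard part. It is only used for those. -/
def dsqrt (a : DualNumber ℝ) : DualNumber ℝ :=
  mk (√a.fst) (a.snd / (2 * √a.fst))

/-- A dual number regarded as a dual quaternion. -/
def ofDual (a : DualNumber ℝ) : DualQuaternion :=
  TrivSqZeroExt.inl (a.fst : Quaternion ℝ) + TrivSqZeroExt.inr (a.snd : Quaternion ℝ)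

/-! ### Dual quaternions and dual quaternion vectors -/

open Classical in
/-- The magnitude of a dual quaternion; `sc` of a quaternion is its real part. -/
def magnitude (q : DualQuaternion) : DualNumber ℝ :=
  if q.fst ≠ 0 then mk ‖q.fst‖ ((star q.fst * q.snd).re / ‖q.fst‖) else mk 0 ‖q.snd‖

open Classical in
/-- The `2`-norm of a dual quaternion vector. -/
def norm2 {n : ℕ} (x : Fin n → DualQuaternion) : DualNumber ℝ :=
  if (∃ i, (x i).fst ≠ 0) then dsqrt (∑ i, magnitude (x i) ^ 2)
  else mk 0 (√(∑ i, ‖(x i).snd‖ ^ 2))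

/-- The dual quaternion vectors with unit `2`-norm. -/
def IsUnitVec {n : ℕ} (x : Fin n → DualQuaternion) : Prop := norm2 x = 1

/-! ### Dual quaternion matrices -/

/-- The standard part of a dual quaternion matrix. -/
def stPart {m n : ℕ} (Q : Matrix (Fin m) (Fin n) DualQuaternion) :
    Matrix (Fin m) (Fin n) (Quaternion ℝ) := Q.map TrivSqZeroExt.fst

/-- The dual part of a dual quaternion matrix. -/
def duPart {m n : ℕ} (Q : Matrix (Fin m) (Fin n) DualQuaternion) :
    Matrix (Fin m) (Fin n) (Quaternion ℝ) := Q.map TrivSqZeroExt.snd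

/-- A dual quaternion matrix is appreciable if its standard part is nonzero. -/
def Appreciable {m n : ℕ} (Q : Matrix (Fin m) (Fin n) DualQuaternion) : Prop := stPart Q ≠ 0

/-- The Frobenius norm of a quaternion matrix. -/
def frob {m n : ℕ} (A : Matrix (Fin m) (Fin n) (Quaternion ℝ)) : ℝ :=
  √(∑ i, ∑ j, ‖A i j‖ ^ 2)

open Classical in
/-- The `F`-norm of a dual quaternion matrix. -/
def normF {m n : ℕ} (Q : Matrix (Fin m) (Fin n) DualQuaternion) : DualNumber ℝ :=
  if stPart Q ≠ 0 then
    mk (frob (stPart Q)) (((stPart Q).conjTranspose * duPart Q).trace.re / frob (stPart Q))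
  else mk 0 (frob (duPart Q))

open Classical in
/-- The `F*`-norm of a dual quaternion matrix. -/
def normFStar {m n : ℕ} (Q : Matrix (Fin m) (Fin n) DualQuaternion) : DualNumber ℝ :=
  if stPart Q ≠ 0 then
    mk (frob (stPart Q)) (frob (duPart Q) ^ 2 / (2 * frob (stPart Q)))
  else mk 0 (frob (duPart Q))

/-- The rank of a dual quaternion matrix: the least `k` such that the matrix is a product of
an `m × k` and a `k × n` dual quaternion matrix. By the singular value decomposition this is the
number of nonzero (appreciable or infinitesimal) singular values. -/
def rank {m n : ℕ} (Q : Matrix (Fin m) (Fin n) DualQuaternion) : ℕ :=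
  sInf {k : ℕ | ∃ (B : Matrix (Fin m) (Fin k) DualQuaternion)
    (C : Matrix (Fin k) (Fin n) DualQuaternion), Q = B * C}

/-! ### Eigenvalues -/

/-- The dual number `a` is an eigenvalue of `Q` with eigenvector `u`: `u` is appreciable and
`Q u = u a`. -/
def IsEigenpair {n : ℕ} (Q : Matrix (Fin n) (Fin n) DualQuaternion) (a : DualNumber ℝ)
    (u : Fin n → DualQuaternion) : Prop :=
  (∃ i, (u i).fst ≠ 0) ∧ Q.mulVec u = fun i => u i * ofDual a

/-- The dual number `a` is an eigenvalue of `Q`. -/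
def IsEigenvalue {n : ℕ} (Q : Matrix (Fin n) (Fin n) DualQuaternion) (a : DualNumber ℝ) : Prop :=
  ∃ u, IsEigenpair Q a u

/-- `a` is a dominant eigenvalue of `Q` and `u` a dominant eigenvector corresponding to it: no
eigenvalue has a standard part of larger absolute value. -/
def IsDominantPair {n : ℕ} (Q : Matrix (Fin n) (Fin n) DualQuaternion) (a : DualNumber ℝ)
    (u : Fin n → DualQuaternion) : Prop :=
  IsEigenpair Q a u ∧ ∀ b, IsEigenvalue Q b → |b.fst| ≤ |a.fst|

/-- `a` comes first when the eigenvalues of `Q` are listed in descending order of their absolute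
values, which are dual numbers compared in the total order. -/
def IsFirstInOrder {n : ℕ} (Q : Matrix (Fin n) (Fin n) DualQuaternion) (a : DualNumber ℝ) : Prop :=
  ∀ b, IsEigenvalue Q b → dle (dabs b) (dabs a)

/-! ### Rank-one approximation -/

/-- The residual `Q - a u u*`. -/
def residual {n : ℕ} (Q : Matrix (Fin n) (Fin n) DualQuaternion) (a : DualNumber ℝ)
    (u : Fin n → DualQuaternion) : Matrix (Fin n) (Fin n) DualQuaternion :=
  Q - ofDual a • Matrix.vecMulVec u (star u)

/-- `(a, u)` minimizes `f` (in the total order of dual numbers) over all dual numbers and all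
dual quaternion vectors with unit norm. -/
def IsArgmin {n : ℕ} (f : DualNumber ℝ → (Fin n → DualQuaternion) → DualNumber ℝ)
    (a : DualNumber ℝ) (u : Fin n → DualQuaternion) : Prop :=
  IsUnitVec u ∧ ∀ (b : DualNumber ℝ) (v : Fin n → DualQuaternion), IsUnitVec v →
    dle (f a u) (f b v)

end

end DualMat

/-! For a unit vector `v`, write `r` for the dual Rayleigh quotient sc(v*Qv). Expanding the squared
`F`-norm of the residual gives ‖Q‖² - 2br + b² = ‖Q‖² - r² + (b - r)² (`normF_residual_sq`). At a
unit eigenvector `r` is the eigenvalue, and the value is ‖Q‖² - a². Since (b - r)² is never negative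
in the lexicographic order, (i) reduces to r² ≤ a² (`rayleigh_sq_le`). Regard quaternion vectors as
a real Euclidean space, so that `Q` becomes a first-order perturbation T + Sε of a symmetric
operator. Degenerate perturbation theory, i.e. compressing `S` to an extremal eigenspace of `T`,
yields a dual eigenvalue whose square bounds r² (`exists_dual_eigenvalue_ge`).

For (ii), a rank-one Hermitian matrix equals a u u* exactly once `a` is appreciable
(`residual_eq_zero`). The residual is then zero, and no squared `F*`-norm is below zero. -/

open RealInnerProductSpace

/-! ### Extremal eigenvalues of symmetric operators and of their first-order perturbations. -/

namespace LinearMap.IsSymmetric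

variable {E : Type*} [NormedAddCommGroup E] [InnerProductSpace ℝ E]

/-- A vector on which a positive semidefinite quadratic form vanishes is in its kernel. -/
theorem apply_eq_zero_of_inner_nonneg {P : E →ₗ[ℝ] E} (hP : P.IsSymmetric)
    (hpos : ∀ v, 0 ≤ ⟪P v, v⟫) {v : E} (hv : ⟪P v, v⟫ = 0) : P v = 0 := by
  -- The form at v - t P v is a quadratic in t without constant term, so its discriminant 4‖Pv‖⁴
  -- cannot be positive.
  have key : ∀ t : ℝ, 0 ≤ ⟪P (P v), P v⟫ * (t * t) + (-2 * ⟪P v, P v⟫) * t + 0 := by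
    intro t
    have h := hpos (v - t • P v)
    have h2 : ⟪P (P v), v⟫ = ⟪P v, P v⟫ := hP _ _
    simp only [map_sub, map_smul, inner_sub_left, inner_sub_right, real_inner_smul_left,
      real_inner_smul_right, hv, h2] at h
    linarith
  have hd := discrim_le_zero key
  have h0 : ⟪P v, P v⟫ = 0 := by
    simp only [discrim] at hd
    nlinarith [sq_nonneg ⟪P v, P v⟫]
  exact inner_self_eq_zero.mp h0

variable [FiniteDimensional ℝ E]

/-- The largest eigenvalue of a symmetric operator bounds its quadratic form, with equality only
on the eigenspace. -/
theorem exists_max_eigenvalue [Nontrivial E] {T : E →ₗ[ℝ] E} (hT : T.IsSymmetric) :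
    ∃ μ : ℝ, (∃ w, w ≠ 0 ∧ T w = μ • w) ∧ (∀ v, ⟪T v, v⟫ ≤ μ * ‖v‖ ^ 2) ∧
      ∀ v, ⟪T v, v⟫ = μ * ‖v‖ ^ 2 → T v = μ • v := by
  have h := hT.hasEigenvalue_iSup_of_finiteDimensional
  set μ : ℝ := ⨆ x : { x : E // x ≠ 0 }, RCLike.re ⟪T x, x⟫ / ‖(x : E)‖ ^ 2 with hμ
  obtain ⟨w, hw⟩ := h.exists_hasEigenvector
  have hle : ∀ v, ⟪T v, v⟫ ≤ μ * ‖v‖ ^ 2 := by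
    intro v
    by_cases hv : v = 0
    · simp [hv]
    have hb : BddAbove (Set.range fun x : { x : E // x ≠ 0 } =>
        RCLike.re ⟪T x, x⟫ / ‖(x : E)‖ ^ 2) := by
      refine ⟨‖T.toContinuousLinearMap‖, ?_⟩
      rintro _ ⟨x, rfl⟩
      exact (le_abs_self _).trans
        (ContinuousLinearMap.rayleighQuotient_le_norm T.toContinuousLinearMap (x : E))
    have := le_ciSup hb ⟨v, hv⟩
    rw [← hμ] at this
    have hpos : 0 < ‖v‖ ^ 2 := by positivity
    exact (div_le_iff₀ hpos).mp this
  refine ⟨μ, ⟨w, hw.2, hw.apply_eq_smul⟩, hle, fun v hv => ?_⟩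
  -- In the equality case the positive semidefinite form of μ - T vanishes at `v`, so `v` lies in
  -- its kernel.
  have hP : (μ • LinearMap.id - T).IsSymmetric := by
    intro x y
    simp [inner_sub_left, inner_sub_right, real_inner_smul_left, real_inner_smul_right, hT x y]
  have := hP.apply_eq_zero_of_inner_nonneg (v := v)
    (fun x => by
      have := hle x
      simp [inner_sub_left, real_inner_smul_left]
      linarith)
    (by simp [inner_sub_left, real_inner_smul_left, hv])
  exact (sub_eq_zero.mp (by simpa using this)).symm

/-- A first-order perturbation `T + S ε` of a symmetric operator has a first-order eigenpair over
the eigenvalue `σ` of `T` whose dual part bounds the quadratic form of `S` on the eigenspace. -/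
theorem exists_dual_eigenvalue {T S : E →ₗ[ℝ] E} (hT : T.IsSymmetric) (hS : S.IsSymmetric)
    {σ : ℝ} (hσ : ∃ w, w ≠ 0 ∧ T w = σ • w) :
    ∃ (μ : ℝ) (w x : E), w ≠ 0 ∧ T w = σ • w ∧ S w + T x = μ • w + σ • x ∧
      ∀ v, T v = σ • v → ⟪S v, v⟫ ≤ μ * ‖v‖ ^ 2 := by
  set R : E →ₗ[ℝ] E := T - σ • LinearMap.id with hR
  have hRs : R.IsSymmetric := by
    intro x y
    simp [hR, inner_sub_left, inner_sub_right, real_inner_smul_left, real_inner_smul_right, hT x y]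
  set K := LinearMap.ker R with hK
  have memK : ∀ v, v ∈ K ↔ T v = σ • v := fun v => by simp [hK, hR, sub_eq_zero]
  -- `C` is the compression of `S` to the σ-eigenspace; its largest eigenvalue is the required μ.
  set C : K →ₗ[ℝ] K := (K.orthogonalProjectionOnto : E →ₗ[ℝ] K) ∘ₗ S ∘ₗ K.subtype with hC
  have hCi : ∀ x y : K, ⟪C x, y⟫ = ⟪S x, (y : E)⟫ := fun x y => by
    simp [hC]
  have hCs : C.IsSymmetric := fun x y => by
    rw [hCi, hS, real_inner_comm, ← hCi, real_inner_comm]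
  obtain ⟨w₀, hw₀, hTw₀⟩ := hσ
  have : Nontrivial K := ⟨⟨w₀, (memK _).2 hTw₀⟩, 0, fun h => hw₀ (congrArg Subtype.val h)⟩
  obtain ⟨μ, ⟨w, hw, hCw⟩, hle, -⟩ := hCs.exists_max_eigenvalue
  -- The dual part of the eigenvalue equation reads R x = μw - Sw. It is solvable because the right
  -- side is orthogonal to ker R, and range R = (ker R)ᗮ by symmetry.
  have hmem : μ • (w : E) - S w ∈ LinearMap.range R := by
    have : LinearMap.range R = Kᗮ := by
      rw [hK, ← hRs.orthogonal_range, Submodule.orthogonal_orthogonal]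
    rw [this, Submodule.mem_orthogonal']
    intro y hy
    have h := hCi w ⟨y, hy⟩
    rw [hCw] at h
    rw [inner_sub_left, ← h, sub_eq_zero]
    rfl
  obtain ⟨x, hx⟩ := hmem
  refine ⟨μ, w, x, by simpa using hw, (memK _).1 w.2, ?_, fun v hv => ?_⟩
  · have : T x - σ • x = μ • (w : E) - S w := by simpa [hR] using hx
    rw [sub_eq_sub_iff_add_eq_add] at this
    rw [add_comm, this]
  · have := hle ⟨v, (memK v).2 hv⟩
    rwa [hCi] at this

/-- The Rayleigh quotient of a first-order perturbation `T + S ε` at the unit vector `v + y ε` is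
dominated in magnitude by an eigenvalue of that perturbation. -/
theorem exists_dual_eigenvalue_ge {T S : E →ₗ[ℝ] E} (hT : T.IsSymmetric) (hS : S.IsSymmetric)
    {v y : E} (hv : ‖v‖ = 1) (hvy : ⟪v, y⟫ = 0) :
    ∃ (σ μ : ℝ) (w x : E), w ≠ 0 ∧ T w = σ • w ∧ S w + T x = μ • w + σ • x ∧
      (⟪T v, v⟫ ^ 2 < σ ^ 2 ∨ ⟪T v, v⟫ ^ 2 = σ ^ 2 ∧
        ⟪T v, v⟫ * (⟪S v, v⟫ + 2 * ⟪T v, y⟫) ≤ σ * μ) := by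
  -- It suffices to treat a nonnegative Rayleigh quotient: passing to (-T, -S) changes the signs of
  -- both σ and μ, leaving σ² and σμ unchanged.
  have aux : ∀ {T S : E →ₗ[ℝ] E}, T.IsSymmetric → S.IsSymmetric → 0 ≤ ⟪T v, v⟫ →
      ∃ (σ μ : ℝ) (w x : E), w ≠ 0 ∧ T w = σ • w ∧ S w + T x = μ • w + σ • x ∧
      (⟪T v, v⟫ ^ 2 < σ ^ 2 ∨ ⟪T v, v⟫ ^ 2 = σ ^ 2 ∧
        ⟪T v, v⟫ * (⟪S v, v⟫ + 2 * ⟪T v, y⟫) ≤ σ * μ) := by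
    intro T S hT hS h0
    have : Nontrivial E := ⟨v, 0, fun h => by simp [h] at hv⟩
    obtain ⟨σ, hσ, hle, heq⟩ := hT.exists_max_eigenvalue
    obtain ⟨μ, w, x, hw, hTw, hx, hmax⟩ := hT.exists_dual_eigenvalue hS hσ
    refine ⟨σ, μ, w, x, hw, hTw, hx, ?_⟩
    have h1 : ⟪T v, v⟫ ≤ σ := by simpa [hv] using hle v
    rcases h1.lt_or_eq with h1 | h1
    · exact Or.inl (by nlinarith)
    · have hTv := heq v (by simpa [hv] using h1)
      have hSv : ⟪S v, v⟫ ≤ μ := by simpa [hv] using hmax v hTv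
      refine Or.inr ⟨by rw [h1], ?_⟩
      -- Here `v` is an eigenvector, so the first-order variation of `v` contributes nothing.
      have : ⟪T v, y⟫ = 0 := by rw [hTv, real_inner_smul_left, hvy, mul_zero]
      rw [this, h1]
      rw [h1] at h0
      nlinarith
  rcases le_total 0 ⟪T v, v⟫ with h0 | h0
  · exact aux hT hS h0
  · have neg : ∀ {A : E →ₗ[ℝ] E}, A.IsSymmetric → (-A).IsSymmetric := fun hA x y => by
      simp [hA x y]
    obtain ⟨σ, μ, w, x, hw, hTw, hx, h⟩ := aux (neg hT) (neg hS) (by simpa using h0)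
    refine ⟨-σ, -μ, w, x, hw, ?_, ?_, ?_⟩
    · rw [neg_smul, ← hTw]; simp
    · rw [neg_smul, neg_smul, ← neg_add, ← hx]; simp [add_comm]
    · simp only [LinearMap.neg_apply, inner_neg_left] at h
      rcases h with h | ⟨h, h'⟩
      · exact Or.inl (by linarith)
      · exact Or.inr ⟨by linarith, by linarith⟩

end LinearMap.IsSymmetric

namespace DualMat

/-! ### Dual numbers inside the dual quaternions -/

@[simp] theorem fst_ofDual (a : DualNumber ℝ) : (ofDual a).fst = (a.fst : Quaternion ℝ) := by
  simp [ofDual]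

@[simp] theorem snd_ofDual (a : DualNumber ℝ) : (ofDual a).snd = (a.snd : Quaternion ℝ) := by
  simp [ofDual]

theorem ofDual_fst_ne_zero {a : DualNumber ℝ} (ha : a.fst ≠ 0) : (ofDual a).fst ≠ 0 := by
  intro h
  rw [fst_ofDual] at h
  exact ha (congrArg (fun q : Quaternion ℝ => q.re) h)

theorem ofDual_one : ofDual 1 = 1 := by
  apply TrivSqZeroExt.ext <;> simp

theorem ofDual_mul_comm (a : DualNumber ℝ) (q : DualQuaternion) :
    ofDual a * q = q * ofDual a := by
  apply TrivSqZeroExt.ext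
  · simp [Quaternion.coe_commutes]
  · simp [Quaternion.coe_commutes, add_comm]

theorem star_ofDual (a : DualNumber ℝ) : star (ofDual a) = ofDual a := by
  apply TrivSqZeroExt.ext <;> simp

/-- A dual quaternion with nonzero standard part is invertible. -/
theorem isUnit_of_fst_ne_zero {q : DualQuaternion} (hq : q.fst ≠ 0) : IsUnit q :=
  TrivSqZeroExt.isUnit_iff_isUnit_fst.mpr (isUnit_iff_ne_zero.mpr hq)

/-- The scalar part of a dual quaternion. -/
noncomputable def scalarPart (q : DualQuaternion) : DualNumber ℝ := mk q.fst.re q.snd.re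

@[simp] theorem fst_scalarPart (q : DualQuaternion) : (scalarPart q).fst = q.fst.re := by
  simp [scalarPart]

@[simp] theorem snd_scalarPart (q : DualQuaternion) : (scalarPart q).snd = q.snd.re := by
  simp [scalarPart]

theorem scalarPart_add (p q : DualQuaternion) :
    scalarPart (p + q) = scalarPart p + scalarPart q := by
  apply TrivSqZeroExt.ext <;> simp

theorem scalarPart_sub (p q : DualQuaternion) :
    scalarPart (p - q) = scalarPart p - scalarPart q := by
  apply TrivSqZeroExt.ext <;> simp

theorem scalarPart_sum {ι : Type*} (s : Finset ι) (f : ι → DualQuaternion) :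
    scalarPart (∑ i ∈ s, f i) = ∑ i ∈ s, scalarPart (f i) :=
  map_sum (AddMonoidHom.mk' scalarPart scalarPart_add) f s

theorem scalarPart_mul_comm (p q : DualQuaternion) :
    scalarPart (p * q) = scalarPart (q * p) := by
  apply TrivSqZeroExt.ext
  · simp [Quaternion.re_mul]; ring
  · simp [Quaternion.re_mul]; ring

theorem scalarPart_star (q : DualQuaternion) : scalarPart (star q) = scalarPart q := by
  apply TrivSqZeroExt.ext <;> simp

theorem scalarPart_ofDual (a : DualNumber ℝ) : scalarPart (ofDual a) = a := by
  apply TrivSqZeroExt.ext <;> simp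

theorem scalarPart_ofDual_mul (a : DualNumber ℝ) (q : DualQuaternion) :
    scalarPart (ofDual a * q) = a * scalarPart q := by
  apply TrivSqZeroExt.ext <;> simp

/-- A self-conjugate dual quaternion is a dual number. -/
theorem ofDual_scalarPart {q : DualQuaternion} (hq : star q = q) : ofDual (scalarPart q) = q := by
  have h1 := congrArg TrivSqZeroExt.fst hq
  have h2 := congrArg TrivSqZeroExt.snd hq
  rw [DualQuaternion.fst_star, Quaternion.star_eq_self] at h1
  rw [DualQuaternion.snd_star, Quaternion.star_eq_self] at h2
  apply TrivSqZeroExt.ext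
  · simpa using h1.symm
  · simpa using h2.symm

/-- The squared magnitude of a dual quaternion. -/
noncomputable def normSq (q : DualQuaternion) : DualNumber ℝ := scalarPart (star q * q)

theorem ofDual_normSq (q : DualQuaternion) : ofDual (normSq q) = star q * q :=
  ofDual_scalarPart (by simp)

theorem fst_normSq (q : DualQuaternion) : (normSq q).fst = ‖q.fst‖ ^ 2 := by
  rw [sq, ← Quaternion.normSq_eq_norm_mul_self]
  simp [normSq, Quaternion.normSq_def']
  ring

theorem snd_normSq (q : DualQuaternion) : (normSq q).snd = 2 * (star q.fst * q.snd).re := by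
  simp [normSq, Quaternion.re_mul]
  ring

theorem fst_sq (a : DualNumber ℝ) : (a ^ 2).fst = a.fst ^ 2 := by
  simp

theorem snd_sq (a : DualNumber ℝ) : (a ^ 2).snd = 2 * a.fst * a.snd := by
  rw [sq]; simp; ring

theorem magnitude_sq (q : DualQuaternion) : magnitude q ^ 2 = normSq q := by
  unfold magnitude
  split_ifs with h
  · have : ‖q.fst‖ ≠ 0 := norm_ne_zero_iff.mpr h
    apply TrivSqZeroExt.ext
    · rw [fst_sq, fst_mk, fst_normSq]
    · rw [snd_sq, fst_mk, snd_mk, snd_normSq]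
      field_simp
  · push Not at h
    apply TrivSqZeroExt.ext
    · rw [fst_sq, fst_mk, fst_normSq, h]; simp
    · rw [snd_sq, fst_mk, snd_normSq, h]; simp; rfl

theorem IsUnitVec.sum_normSq {n : ℕ} {u : Fin n → DualQuaternion} (hu : IsUnitVec u) :
    ∑ i, normSq (u i) = 1 := by
  unfold IsUnitVec norm2 at hu
  split_ifs at hu with h
  · simp only [magnitude_sq] at hu
    have h1 := congrArg TrivSqZeroExt.fst hu
    have h2 := congrArg TrivSqZeroExt.snd hu
    simp only [dsqrt, fst_mk, snd_mk, TrivSqZeroExt.fst_one, TrivSqZeroExt.snd_one] at h1 h2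
    rw [h1] at h2
    apply TrivSqZeroExt.ext
    · exact Real.sqrt_eq_one.mp h1
    · simpa using h2
  · have := congrArg TrivSqZeroExt.fst hu
    simp at this

theorem IsUnitVec.sum_star_mul {n : ℕ} {u : Fin n → DualQuaternion} (hu : IsUnitVec u) :
    ∑ i, star (u i) * u i = 1 := by
  have hs : star (∑ i, star (u i) * u i) = ∑ i, star (u i) * u i := by simp
  rw [← ofDual_scalarPart hs, scalarPart_sum]
  change ofDual (∑ i, normSq (u i)) = 1
  rw [hu.sum_normSq, ofDual_one]

theorem quaternion_re_sum {ι : Type*} (s : Finset ι) (f : ι → Quaternion ℝ) :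
    (∑ i ∈ s, f i).re = ∑ i ∈ s, (f i).re :=
  map_sum (AddMonoidHom.mk' (fun q : Quaternion ℝ => q.re) fun _ _ => rfl) f s

/-! ### The squared norms of a matrix -/

theorem frob_sq {m n : ℕ} (A : Matrix (Fin m) (Fin n) (Quaternion ℝ)) :
    frob A ^ 2 = ∑ i, ∑ j, ‖A i j‖ ^ 2 :=
  Real.sq_sqrt (by positivity)

theorem frob_eq_zero_iff {m n : ℕ} {A : Matrix (Fin m) (Fin n) (Quaternion ℝ)} :
    frob A = 0 ↔ A = 0 := by
  rw [frob, Real.sqrt_eq_zero (by positivity)]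
  constructor
  · intro h
    ext1 i j
    have h1 := (Finset.sum_eq_zero_iff_of_nonneg fun i _ => by positivity).mp h i (Finset.mem_univ _)
    have h2 := (Finset.sum_eq_zero_iff_of_nonneg fun i _ => by positivity).mp h1 j
      (Finset.mem_univ _)
    simpa using h2
  · rintro rfl
    simp

/-- Squaring removes the case split, since an infinitesimal norm squares to zero, and makes the norm
additive over entries. -/
theorem normF_sq {m n : ℕ} (Q : Matrix (Fin m) (Fin n) DualQuaternion) :
    normF Q ^ 2 = ∑ i, ∑ j, normSq (Q i j) := by
  have e1 : (∑ i, ∑ j, normSq (Q i j)).fst = frob (stPart Q) ^ 2 := by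
    rw [frob_sq]; simp [TrivSqZeroExt.fst_sum, fst_normSq, stPart]
  have e2 : (∑ i, ∑ j, normSq (Q i j)).snd =
      2 * ((stPart Q).conjTranspose * duPart Q).trace.re := by
    simp only [TrivSqZeroExt.snd_sum, snd_normSq, ← Finset.mul_sum, Matrix.trace, Matrix.diag,
      Matrix.mul_apply, Matrix.conjTranspose_apply, stPart, duPart, Matrix.map_apply]
    rw [Finset.sum_comm]
    congr 1
    simp only [quaternion_re_sum]
  unfold normF
  split_ifs with h
  · have := mt frob_eq_zero_iff.mp h
    apply TrivSqZeroExt.ext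
    · rw [fst_sq, fst_mk, e1]
    · rw [snd_sq, fst_mk, snd_mk, e2]
      field_simp
  · push Not at h
    rw [h] at e1 e2
    apply TrivSqZeroExt.ext
    · rw [fst_sq, fst_mk, e1, frob_eq_zero_iff.mpr rfl]
    · rw [snd_sq, fst_mk, e2]; simp; rfl

theorem fst_normFStar_sq_nonneg {m n : ℕ} (Q : Matrix (Fin m) (Fin n) DualQuaternion) :
    0 ≤ (normFStar Q ^ 2).fst := by
  rw [fst_sq]; positivity

/-- In the appreciable case this dual part is ‖Q_I‖², otherwise 0; for the `F`-norm it can be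
negative. -/
theorem snd_normFStar_sq_nonneg {m n : ℕ} (Q : Matrix (Fin m) (Fin n) DualQuaternion) :
    0 ≤ (normFStar Q ^ 2).snd := by
  rw [snd_sq]
  unfold normFStar frob
  split_ifs <;> rw [fst_mk, snd_mk] <;> positivity

theorem normFStar_zero {m n : ℕ} : normFStar (0 : Matrix (Fin m) (Fin n) DualQuaternion) = 0 := by
  have h : stPart (0 : Matrix (Fin m) (Fin n) DualQuaternion) = 0 := by ext1 i j; simp [stPart]
  have h' : duPart (0 : Matrix (Fin m) (Fin n) DualQuaternion) = 0 := by ext1 i j; simp [duPart]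
  apply TrivSqZeroExt.ext <;> simp [normFStar, h, h', frob]

/-- The dual Rayleigh quotient `sc (u* Q u)`. -/
noncomputable def rayleigh {n : ℕ} (Q : Matrix (Fin n) (Fin n) DualQuaternion)
    (u : Fin n → DualQuaternion) : DualNumber ℝ :=
  scalarPart (∑ i, star (u i) * Q.mulVec u i)

theorem residual_apply {n : ℕ} (Q : Matrix (Fin n) (Fin n) DualQuaternion) (a : DualNumber ℝ)
    (u : Fin n → DualQuaternion) (i j : Fin n) :
    residual Q a u i j = Q i j - ofDual a * (u i * star (u j)) := by
  simp [residual, Matrix.vecMulVec_apply]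

/-- The two cross terms are conjugate, hence have the same scalar part, and a scalar part is
invariant under cyclic permutation of factors. -/
theorem normSq_sub (a : DualNumber ℝ) (q x y : DualQuaternion) :
    normSq (q - ofDual a * (x * star y)) =
      normSq q - 2 * a * scalarPart (star x * (q * y)) + a ^ 2 * (normSq x * normSq y) := by
  have h1 : scalarPart (star q * (ofDual a * (x * star y))) =
      a * scalarPart (star x * (q * y)) := by
    rw [ofDual_mul_comm, ← mul_assoc, ← ofDual_mul_comm, scalarPart_ofDual_mul, ← scalarPart_star,
      star_mul, star_mul, star_star, star_star, mul_assoc, scalarPart_mul_comm, mul_assoc]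
  have h2 : scalarPart (star (ofDual a * (x * star y)) * q) =
      a * scalarPart (star x * (q * y)) := by
    rw [← h1, ← scalarPart_star, star_mul, star_star]
  have h3 : normSq (ofDual a * (x * star y)) = a ^ 2 * (normSq x * normSq y) := by
    have : star (ofDual a * (x * star y)) * (ofDual a * (x * star y)) =
        ofDual a * (ofDual a * (y * (ofDual (normSq x) * star y))) := by
      rw [ofDual_normSq, star_mul, star_ofDual, star_mul, star_star, ← ofDual_mul_comm]
      simp only [mul_assoc]
      rw [ofDual_mul_comm a (y * _)]
      simp only [mul_assoc, ofDual_mul_comm]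
    rw [normSq, this, scalarPart_ofDual_mul, scalarPart_ofDual_mul, scalarPart_mul_comm, mul_assoc,
      scalarPart_ofDual_mul, ← normSq]
    ring
  rw [normSq, star_sub, sub_mul, mul_sub, mul_sub, scalarPart_sub, scalarPart_sub, scalarPart_sub,
    h1, h2, ← normSq, ← normSq, h3]
  ring

theorem normF_residual_sq {n : ℕ} (Q : Matrix (Fin n) (Fin n) DualQuaternion) (a : DualNumber ℝ)
    {u : Fin n → DualQuaternion} (hu : IsUnitVec u) :
    normF (residual Q a u) ^ 2 = normF Q ^ 2 - 2 * a * rayleigh Q u + a ^ 2 := by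
  have hr : rayleigh Q u = ∑ i, ∑ j, scalarPart (star (u i) * (Q i j * u j)) := by
    simp only [rayleigh, Matrix.mulVec, dotProduct, Finset.mul_sum, scalarPart_sum]
  rw [normF_sq, normF_sq, hr]
  simp only [residual_apply, normSq_sub, Finset.sum_add_distrib, Finset.sum_sub_distrib,
    ← Finset.mul_sum]
  simp only [hu.sum_normSq, mul_one]

theorem rayleigh_eq_of_isEigenpair {n : ℕ} {Q : Matrix (Fin n) (Fin n) DualQuaternion}
    {a : DualNumber ℝ} {u : Fin n → DualQuaternion} (h : IsEigenpair Q a u) (hu : IsUnitVec u) :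
    rayleigh Q u = a := by
  rw [rayleigh, h.2]
  simp only [← mul_assoc, ← Finset.sum_mul]
  rw [hu.sum_star_mul, one_mul, scalarPart_ofDual]

/-! ### Quaternion matrices as operators on a real inner product space -/

/-- Quaternion vectors, as a real Euclidean space. -/
abbrev QuatSpace (n : ℕ) : Type := PiLp 2 fun _ : Fin n => Quaternion ℝ

/-- The real-linear operator `v ↦ A v` of a quaternion matrix. -/
noncomputable def mulVecOp {n : ℕ} (A : Matrix (Fin n) (Fin n) (Quaternion ℝ)) :
    QuatSpace n →ₗ[ℝ] QuatSpace n where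
  toFun v := WithLp.toLp 2 (A.mulVec v.ofLp)
  map_add' v w := by ext1 i; simp [Matrix.mulVec_add]
  map_smul' c v := by ext1 i; simp [Matrix.mulVec_smul]

@[simp] theorem mulVecOp_apply {n : ℕ} (A : Matrix (Fin n) (Fin n) (Quaternion ℝ))
    (v : QuatSpace n) (i : Fin n) : mulVecOp A v i = ∑ j, A i j * v j := rfl

theorem quaternion_re_mul_comm (p q : Quaternion ℝ) : (p * q).re = (q * p).re := by
  simp only [Quaternion.re_mul]; ring

theorem inner_quatSpace {n : ℕ} (v w : QuatSpace n) :
    ⟪v, w⟫ = ∑ i, (star (w i) * v i).re := by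
  simp only [PiLp.inner_apply, Quaternion.inner_def, quaternion_re_mul_comm]

theorem isSymmetric_mulVecOp {n : ℕ} {A : Matrix (Fin n) (Fin n) (Quaternion ℝ)}
    (hA : A.IsHermitian) : (mulVecOp A).IsSymmetric := by
  intro v w
  simp only [inner_quatSpace, mulVecOp_apply, Finset.mul_sum, star_sum, Finset.sum_mul,
    quaternion_re_sum, star_mul]
  rw [Finset.sum_comm]
  refine Finset.sum_congr rfl fun i _ => Finset.sum_congr rfl fun j _ => ?_
  rw [hA.apply, mul_assoc]

theorem isHermitian_stPart {n : ℕ} {Q : Matrix (Fin n) (Fin n) DualQuaternion}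
    (hQ : Q.IsHermitian) : (stPart Q).IsHermitian := by
  ext1 i j
  simp [stPart, ← DualQuaternion.fst_star, hQ.apply]

theorem isHermitian_duPart {n : ℕ} {Q : Matrix (Fin n) (Fin n) DualQuaternion}
    (hQ : Q.IsHermitian) : (duPart Q).IsHermitian := by
  ext1 i j
  simp [duPart, ← DualQuaternion.snd_star, hQ.apply]

/-- The standard part of a dual quaternion vector. -/
noncomputable def stVec {n : ℕ} (u : Fin n → DualQuaternion) : QuatSpace n :=
  WithLp.toLp 2 fun i => (u i).fst

/-- The dual part of a dual quaternion vector. -/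
noncomputable def duVec {n : ℕ} (u : Fin n → DualQuaternion) : QuatSpace n :=
  WithLp.toLp 2 fun i => (u i).snd

@[simp] theorem stVec_apply {n : ℕ} (u : Fin n → DualQuaternion) (i : Fin n) :
    stVec u i = (u i).fst := rfl

@[simp] theorem duVec_apply {n : ℕ} (u : Fin n → DualQuaternion) (i : Fin n) :
    duVec u i = (u i).snd := rfl

theorem fst_mulVec {n : ℕ} (Q : Matrix (Fin n) (Fin n) DualQuaternion)
    (u : Fin n → DualQuaternion) (i : Fin n) :
    (Q.mulVec u i).fst = mulVecOp (stPart Q) (stVec u) i := by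
  simp [Matrix.mulVec, dotProduct, stPart, TrivSqZeroExt.fst_sum]

theorem snd_mulVec {n : ℕ} (Q : Matrix (Fin n) (Fin n) DualQuaternion)
    (u : Fin n → DualQuaternion) (i : Fin n) :
    (Q.mulVec u i).snd =
      (mulVecOp (duPart Q) (stVec u) + mulVecOp (stPart Q) (duVec u)) i := by
  simp [Matrix.mulVec, dotProduct, stPart, duPart, TrivSqZeroExt.snd_sum, Finset.sum_add_distrib,
    add_comm]

theorem fst_rayleigh {n : ℕ} (Q : Matrix (Fin n) (Fin n) DualQuaternion)
    (u : Fin n → DualQuaternion) :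
    (rayleigh Q u).fst = ⟪mulVecOp (stPart Q) (stVec u), stVec u⟫ := by
  simp only [rayleigh, fst_scalarPart, TrivSqZeroExt.fst_sum, quaternion_re_sum, inner_quatSpace,
    TrivSqZeroExt.fst_mul, DualQuaternion.fst_star, fst_mulVec, stVec_apply]

/-- Symmetry of the standard part merges the two terms containing the dual part of `u`. -/
theorem snd_rayleigh {n : ℕ} {Q : Matrix (Fin n) (Fin n) DualQuaternion} (hQ : Q.IsHermitian)
    (u : Fin n → DualQuaternion) :
    (rayleigh Q u).snd = ⟪mulVecOp (duPart Q) (stVec u), stVec u⟫ +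
      2 * ⟪mulVecOp (stPart Q) (stVec u), duVec u⟫ := by
  have h : ⟪mulVecOp (stPart Q) (duVec u), stVec u⟫ =
      ⟪mulVecOp (stPart Q) (stVec u), duVec u⟫ := by
    rw [isSymmetric_mulVecOp (isHermitian_stPart hQ), real_inner_comm]
  have e : (rayleigh Q u).snd =
      ⟪mulVecOp (duPart Q) (stVec u) + mulVecOp (stPart Q) (duVec u), stVec u⟫ +
      ⟪mulVecOp (stPart Q) (stVec u), duVec u⟫ := by
    simp only [rayleigh, snd_scalarPart, TrivSqZeroExt.snd_sum, quaternion_re_sum, inner_quatSpace,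
      TrivSqZeroExt.snd_mul, DualQuaternion.fst_star, DualQuaternion.snd_star, fst_mulVec,
      snd_mulVec, stVec_apply, duVec_apply, ← Finset.sum_add_distrib, smul_eq_mul,
      MulOpposite.smul_eq_mul_unop, MulOpposite.unop_op, Quaternion.re_add]
  rw [e, inner_add_left, h]
  ring

theorem IsUnitVec.norm_stVec {n : ℕ} {u : Fin n → DualQuaternion} (hu : IsUnitVec u) :
    ‖stVec u‖ = 1 := by
  have h := congrArg TrivSqZeroExt.fst hu.sum_normSq
  simp only [TrivSqZeroExt.fst_sum, fst_normSq, TrivSqZeroExt.fst_one] at h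
  rw [PiLp.norm_eq_of_L2]
  simp [h]

theorem IsUnitVec.inner_stVec_duVec {n : ℕ} {u : Fin n → DualQuaternion} (hu : IsUnitVec u) :
    ⟪stVec u, duVec u⟫ = 0 := by
  have h := congrArg TrivSqZeroExt.snd hu.sum_normSq
  simp only [TrivSqZeroExt.snd_sum, snd_normSq, TrivSqZeroExt.snd_one, ← Finset.mul_sum] at h
  rw [real_inner_comm, inner_quatSpace]
  simpa using h

/-- A first-order eigenpair of the operator `Q_st + Q_I ε` is an eigenpair of `Q`. -/
theorem isEigenvalue_of_op {n : ℕ} {Q : Matrix (Fin n) (Fin n) DualQuaternion} {σ μ : ℝ}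
    {w x : QuatSpace n} (hw : w ≠ 0) (hst : mulVecOp (stPart Q) w = σ • w)
    (hdu : mulVecOp (duPart Q) w + mulVecOp (stPart Q) x = μ • w + σ • x) :
    IsEigenvalue Q (mk σ μ) := by
  have hs : stVec (fun i => (TrivSqZeroExt.inl (w i) + TrivSqZeroExt.inr (x i) :
      DualQuaternion)) = w := by ext1 i; simp
  have hd : duVec (fun i => (TrivSqZeroExt.inl (w i) + TrivSqZeroExt.inr (x i) :
      DualQuaternion)) = x := by ext1 i; simp
  refine ⟨fun i => TrivSqZeroExt.inl (w i) + TrivSqZeroExt.inr (x i), ?_, ?_⟩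
  · by_contra! h
    exact hw (by ext1 i; simpa using h i)
  · funext i
    apply TrivSqZeroExt.ext
    · rw [fst_mulVec, hs, hst]
      simp [Quaternion.mul_coe_eq_smul]
    · rw [snd_mulVec, hs, hd, hdu]
      simp [Quaternion.mul_coe_eq_smul]

/-! ### Minimality in the `F`-norm. -/

/-- Comparison of magnitudes amounts to comparison of squares. -/
theorem sq_le_sq_of_dabs {a b : DualNumber ℝ} (h : dle (dabs b) (dabs a)) :
    b.fst ^ 2 < a.fst ^ 2 ∨ b.fst ^ 2 = a.fst ^ 2 ∧ b.fst * b.snd ≤ a.fst * a.snd := by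
  have hf : ∀ c, (dabs c).fst = |c.fst| := by
    intro c
    unfold dabs
    split_ifs with hc
    · simp
    · push Not at hc; simp [hc]
  -- This is half the dual part of c². Both sides vanish when `c` is infinitesimal.
  have hs : ∀ c : DualNumber ℝ, c.fst * c.snd = |c.fst| * (dabs c).snd := by
    intro c
    unfold dabs
    split_ifs with hc
    · rw [snd_mk, ← mul_assoc]
      rcases lt_or_gt_of_ne hc with h0 | h0
      · rw [Real.sign_of_neg h0, abs_of_neg h0]; ring
      · rw [Real.sign_of_pos h0, abs_of_pos h0]; ring
    · push Not at hc; simp [hc]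
  rcases h with h | ⟨h, h'⟩
  · rw [hf, hf] at h
    exact Or.inl (sq_lt_sq.mpr h)
  · rw [hf, hf] at h
    refine Or.inr ⟨(sq_eq_sq_iff_abs_eq_abs _ _).mpr h, ?_⟩
    rw [hs, hs, h]
    exact mul_le_mul_of_nonneg_left h' (abs_nonneg _)

/-- The square of the dual Rayleigh quotient at a unit vector is at most the square of the
eigenvalue of largest magnitude. -/
theorem rayleigh_sq_le {n : ℕ} {Q : Matrix (Fin n) (Fin n) DualQuaternion} (hQ : Q.IsHermitian)
    {a : DualNumber ℝ} (ha : IsFirstInOrder Q a) {v : Fin n → DualQuaternion} (hv : IsUnitVec v) :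
    (rayleigh Q v).fst ^ 2 < a.fst ^ 2 ∨ (rayleigh Q v).fst ^ 2 = a.fst ^ 2 ∧
      (rayleigh Q v).fst * (rayleigh Q v).snd ≤ a.fst * a.snd := by
  obtain ⟨σ, μ, w, x, hw, hst, hdu, h⟩ :=
    (isSymmetric_mulVecOp (isHermitian_stPart hQ)).exists_dual_eigenvalue_ge
      (isSymmetric_mulVecOp (isHermitian_duPart hQ)) hv.norm_stVec hv.inner_stVec_duVec
  rw [← snd_rayleigh hQ, ← fst_rayleigh] at h
  have hb := sq_le_sq_of_dabs (ha _ (isEigenvalue_of_op hw hst hdu))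
  rw [fst_mk, snd_mk] at hb
  rcases h with h | ⟨h, h'⟩ <;> rcases hb with hb | ⟨hb, hb'⟩
  · exact Or.inl (h.trans hb)
  · exact Or.inl (hb ▸ h)
  · exact Or.inl (h ▸ hb)
  · exact Or.inr ⟨h.trans hb, h'.trans hb'⟩

theorem isArgmin_normF {n : ℕ} {Q : Matrix (Fin n) (Fin n) DualQuaternion} (hQ : Q.IsHermitian)
    {a : DualNumber ℝ} {u : Fin n → DualQuaternion} (hu : IsUnitVec u) (h : IsEigenpair Q a u)
    (ha : IsFirstInOrder Q a) : IsArgmin (fun a u => normF (residual Q a u) ^ 2) a u := by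
  refine ⟨hu, fun b v hv => ?_⟩
  simp only [normF_residual_sq Q _ hu, normF_residual_sq Q _ hv, rayleigh_eq_of_isEigenpair h hu]
  have hle := rayleigh_sq_le hQ ha hv
  generalize rayleigh Q v = r at hle
  have e : ∀ c s : DualNumber ℝ, normF Q ^ 2 - 2 * c * s + c ^ 2 = normF Q ^ 2 + c * (c - 2 * s) :=
    fun c s => by ring
  have two : (2 : DualNumber ℝ) = mk 2 0 := by
    rw [show (2 : DualNumber ℝ) = 1 + 1 by norm_num]
    apply TrivSqZeroExt.ext <;> simp
    norm_num
  rw [e, e]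
  simp only [dle, TrivSqZeroExt.fst_add, TrivSqZeroExt.snd_add, TrivSqZeroExt.fst_mul,
    TrivSqZeroExt.snd_mul, TrivSqZeroExt.fst_sub, TrivSqZeroExt.snd_sub, two, fst_mk, snd_mk,
    smul_eq_mul, MulOpposite.smul_eq_mul_unop, MulOpposite.unop_op]
  rcases hle with h1 | ⟨h1, h2⟩
  · left
    nlinarith [sq_nonneg (b.fst - r.fst)]
  -- When the standard parts agree, (b - r)² is exactly zero and the dual parts of a² and r² decide;
  -- otherwise (b - r)² has positive standard part.
  · by_cases hb : b.fst = r.fst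
    · right
      rw [hb]
      exact ⟨by linarith, by linarith⟩
    · left
      have : 0 < (b.fst - r.fst) ^ 2 := by
        have := sub_ne_zero.mpr hb
        positivity
      nlinarith

/-! ### Rank one -/

theorem exists_eq_mul_of_rank_eq_one {m n : ℕ} {Q : Matrix (Fin m) (Fin n) DualQuaternion}
    (h : rank Q = 1) : ∃ (b : Fin m → DualQuaternion) (c : Fin n → DualQuaternion),
      ∀ i j, Q i j = b i * c j := by
  -- The infimum of the empty set is 0, so rank 1 guarantees that a factorization exists.
  have hne : {k : ℕ | ∃ (B : Matrix (Fin m) (Fin k) DualQuaternion)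
      (C : Matrix (Fin k) (Fin n) DualQuaternion), Q = B * C}.Nonempty :=
    Nat.nonempty_of_sInf_eq_succ h
  obtain ⟨B, C, hBC⟩ : rank Q ∈ {k : ℕ | ∃ (B : Matrix (Fin m) (Fin k) DualQuaternion)
      (C : Matrix (Fin k) (Fin n) DualQuaternion), Q = B * C} := Nat.sInf_mem hne
  generalize rank Q = k at h B C hBC
  subst h
  exact ⟨fun i => B i 0, fun j => C 0 j, fun i j => by rw [hBC]; simp [Matrix.mul_apply]⟩

variable {n : ℕ} {Q : Matrix (Fin n) (Fin n) DualQuaternion} {b c : Fin n → DualQuaternion}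

theorem mulVec_of_eq_mul (hbc : ∀ i j, Q i j = b i * c j) (u : Fin n → DualQuaternion)
    (i : Fin n) : Q.mulVec u i = b i * ∑ j, c j * u j := by
  simp only [Matrix.mulVec, dotProduct, hbc, Finset.mul_sum, mul_assoc]

/-- An appreciable Hermitian matrix `b c` with a column `b` and a row `c` has an appreciable
eigenvalue. -/
theorem exists_isEigenvalue_fst_ne_zero (hQ : Q.IsHermitian) (happ : Appreciable Q)
    (hbc : ∀ i j, Q i j = b i * c j) : ∃ t, IsEigenvalue Q t ∧ t.fst ≠ 0 := by
  have hb : ∃ i, (b i).fst ≠ 0 := by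
    by_contra! h
    exact happ (by ext1 i j; simp [stPart, hbc, h])
  set q := ∑ j, c j * b j with hq
  set s := ∑ i, normSq (b i) with hs
  have hs' : ofDual s = ∑ i, star (b i) * b i := by
    have : star (∑ i, star (b i) * b i) = ∑ i, star (b i) * b i := by simp
    rw [← ofDual_scalarPart this, scalarPart_sum]
    rfl
  have hs0 : s.fst ≠ 0 := by
    simp only [hs, TrivSqZeroExt.fst_sum, fst_normSq]
    obtain ⟨i, hi⟩ := hb
    refine (Finset.sum_pos' (fun i _ => by positivity) ⟨i, Finset.mem_univ _, ?_⟩).ne'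
    have := norm_pos_iff.mpr hi
    positivity
  have hsu : IsUnit (ofDual s) := isUnit_of_fst_ne_zero (ofDual_fst_ne_zero hs0)
  -- The column `b` is itself an eigenvector, with eigenvalue q = cb. Multiplying bc = c*b* on the
  -- left by b* gives s c = q* b*.
  have hsc : ∀ j, ofDual s * c j = star q * star (b j) := fun j => by
    rw [hs', Finset.sum_mul, hq, star_sum, Finset.sum_mul]
    refine Finset.sum_congr rfl fun i _ => ?_
    rw [mul_assoc, ← hbc, ← hQ.apply, hbc, star_mul, star_mul, mul_assoc]
  -- Multiplying s c = q* b* by `b` gives s q = q* s; the dual number `s` is central and invertible,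
  -- so `q` is a dual number.
  have hself : star q = q := by
    refine (hsu.mul_left_cancel ?_).symm
    rw [hq, Finset.mul_sum, ← hq]
    simp only [← mul_assoc, hsc]
    simp only [mul_assoc]
    rw [← Finset.mul_sum, ← hs', ofDual_mul_comm]
  refine ⟨scalarPart q, ⟨b, hb, ?_⟩, ?_⟩
  · funext i
    rw [mulVec_of_eq_mul hbc, ofDual_scalarPart hself]
  -- An infinitesimal `q` would make s c, hence `c`, infinitesimal, and Q_st would vanish.
  · intro h0
    have hq0 : q.fst = 0 := by
      have := congrArg TrivSqZeroExt.fst (ofDual_scalarPart hself)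
      rw [fst_ofDual, h0] at this
      simpa using this.symm
    refine happ ?_
    ext1 i j
    have := congrArg TrivSqZeroExt.fst (hsc j)
    simp only [TrivSqZeroExt.fst_mul, DualQuaternion.fst_star, hq0, star_zero, zero_mul,
      mul_eq_zero] at this
    have hc : (c j).fst = 0 := this.resolve_left (ofDual_fst_ne_zero hs0)
    simp [stPart, hbc, hc]

/-- A Hermitian matrix `b c` with a column `b` and a row `c` is recovered from a unit eigenvector
with appreciable eigenvalue. -/
theorem residual_eq_zero (hQ : Q.IsHermitian) (hbc : ∀ i j, Q i j = b i * c j)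
    {a : DualNumber ℝ} {u : Fin n → DualQuaternion} (hu : IsUnitVec u) (h : IsEigenpair Q a u)
    (ha : a.fst ≠ 0) : residual Q a u = 0 := by
  have hau : IsUnit (ofDual a) := isUnit_of_fst_ne_zero (ofDual_fst_ne_zero ha)
  set g := ∑ j, c j * u j with hg
  set k := ∑ i, star (u i) * b i with hk
  have hbg : ∀ i, b i * g = u i * ofDual a := fun i => by
    rw [← mulVec_of_eq_mul hbc, h.2]
  have hkg : k * g = ofDual a := by
    simp only [hk, Finset.sum_mul, mul_assoc, hbg]
    simp only [← mul_assoc, ← Finset.sum_mul]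
    rw [hu.sum_star_mul, one_mul]
  -- Quaternions do not commute, so gk = a is derived from kg = a by cancelling the unit `g`, using
  -- that `a` is central.
  have hgu : IsUnit g := isUnit_of_fst_ne_zero fun h0 => ofDual_fst_ne_zero ha (by
    rw [← hkg, TrivSqZeroExt.fst_mul, h0, mul_zero])
  have hgk : g * k = ofDual a := by
    refine hgu.mul_right_cancel ?_
    rw [mul_assoc, hkg, ofDual_mul_comm]
  -- This is the left eigenvector equation u*Q = a u*, the conjugate of Qu = ua.
  have hkc : ∀ j, k * c j = ofDual a * star (u j) := fun j => by
    have : star (Q.mulVec u j) = ofDual a * star (u j) := by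
      rw [h.2, star_mul, star_ofDual]
    rw [← this, Matrix.mulVec, dotProduct, star_sum, hk, Finset.sum_mul]
    refine Finset.sum_congr rfl fun i _ => ?_
    rw [star_mul, hQ.apply, hbc, mul_assoc]
  ext1 i j
  rw [residual_apply, Matrix.zero_apply, sub_eq_zero]
  refine hau.mul_left_cancel ?_
  -- Inserting a = gk between `b` and `c` turns bc into (bg)(kc) = (ua)(a u*).
  calc ofDual a * Q i j = b i * (g * k) * c j := by
        rw [hgk, hbc, ← ofDual_mul_comm, mul_assoc]
    _ = b i * g * (k * c j) := by simp only [mul_assoc]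
    _ = ofDual a * (ofDual a * (u i * star (u j))) := by
        rw [hbg, hkc, ← ofDual_mul_comm, mul_assoc, ← mul_assoc (u i), ← ofDual_mul_comm,
          mul_assoc]

theorem isArgmin_normFStar (hQ : Q.IsHermitian) (happ : Appreciable Q) {a : DualNumber ℝ}
    {u : Fin n → DualQuaternion} (hu : IsUnitVec u) (h : IsDominantPair Q a u)
    (hrank : rank Q = 1) : IsArgmin (fun a u => normFStar (residual Q a u) ^ 2) a u := by
  obtain ⟨b, c, hbc⟩ := exists_eq_mul_of_rank_eq_one hrank
  obtain ⟨t, ht, ht0⟩ := exists_isEigenvalue_fst_ne_zero hQ happ hbc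
  -- Dominance over an appreciable eigenvalue makes `a` appreciable.
  have ha : a.fst ≠ 0 := abs_pos.mp ((abs_pos.mpr ht0).trans_le (h.2 t ht))
  refine ⟨hu, fun d v _ => ?_⟩
  simp only [residual_eq_zero hQ hbc hu h.1 ha, normFStar_zero]
  have h1 := fst_normFStar_sq_nonneg (residual Q d v)
  have h2 := snd_normFStar_sq_nonneg (residual Q d v)
  rcases h1.lt_or_eq with h1 | h1
  · exact Or.inl (by simpa using h1)
  · exact Or.inr ⟨by simpa using h1, by rw [zero_pow two_ne_zero]; exact h2⟩

end DualMat

theorem lemma4p4 {n : ℕ} (Q : Matrix (Fin n) (Fin n) DualQuaternion)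
    (hQ : Q.IsHermitian) (happ : DualMat.Appreciable Q)
    (a₁ : DualNumber ℝ) (u₁ : Fin n → DualQuaternion)
    (hunit : DualMat.IsUnitVec u₁) (hdom : DualMat.IsDominantPair Q a₁ u₁) :
    (DualMat.IsFirstInOrder Q a₁ →
      DualMat.IsArgmin (fun a u => DualMat.normF (DualMat.residual Q a u) ^ 2) a₁ u₁) ∧
    (DualMat.rank Q = 1 →
      DualMat.IsArgmin (fun a u => DualMat.normFStar (DualMat.residual Q a u) ^ 2) a₁ u₁) :=
  ⟨DualMat.isArgmin_normF hQ hunit hdom.1, DualMat.isArgmin_normFStar hQ happ hunit hdom⟩
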